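/- **Definitions.** A quasi-order $(A,\le_A)$ with a norm $|\cdot|_A:A\to\mathbb N$ (only finitely many elements have norm below any given bound) is called a normed quasi-order. $\mathbb N$ carries its usual order and the identity norm; a power $A^m$ carries the componentwise order and the maximum of the norms of the components. For a normed quasi-order $A$, the set $\mathbb P_f(A)$ of all finite subsets of $A$ carries the *minoring ordering*: $X\sqsubseteq^{\min}Y$ iff for every $y\in Y$ there is $x\in X$ with $x\le_A y$; its norm is $|X|=\max(\{|x|_A : x\in X\}\cup\{\mathrm{card}(X)\})$. For $g:\mathbb N\to\mathbb N$ and $n\in\mathbb N$, a finite sequence $x_0,\dots,x_{\ell-1}$ in $A$ is *bad* if there are no $i<j$ with $x_i\le_A x_j$, and *$(g,n)$-controlled* if $|x_i|_A\le g^i(n)$ for all $i$, where $g^i$ is the $i$-fold iterate. $L_{A,g}(n)$ denotes the supremum (a maximum when finite) of the lengths of $(g,n)$-controlled bad sequences in $A$. For ordinals below $\varepsilon_0$ in Cantor normal form, fix the fundamental sequences $(\gamma+\omega^{\beta+1})(x)=\gamma+\omega^{\beta}\cdot(x+1)$ and $(\gamma+\omega^{\lambda})(x)=\gamma+\omega^{\lambda(x)}$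 for limit $\lambda$, and put $P_x(\alpha+1)=\alpha$ and $P_x(\lambda)=P_x(\lambda(x))$ for limit $\lambda$. For $h:\mathbb N\to\mathbb N$ the Cichon hierarchy is $h_0(x)=0$ and $h_\alpha(x)=1+h_{P_x(\alpha)}(h(x))$ for $\alpha>0$. **Theorem.** Let $d\ge 1$ and $k\ge 0$ be integers and let $\alpha=\omega^{\omega^{d-1}\cdot(2^d\cdot k)}$. There is a constant $c\in\mathbb N$, depending only on $d$ and $k$, such that for every strictly increasing $g:\mathbb N\to\mathbb N$ with $g(n)\ge n$ for all $n$, and for all sufficiently large $n$, $$L_{(\mathbb P_f(\mathbb N^d)^k,\ \le^{\min}),\,g}(n)\ \le\ t_\alpha\bigl(c\cdot g(n)^{2d}\bigr),$$ where $\le^{\min}$ is the componentwise order on $\mathbb P_f(\mathbb N^d)^k$ coming from $\sqsubseteq^{\min}$, $t(x)=4kx\cdot q(g(x))$ and $q(x)=(x+1)^d$. In particular the left-hand side is finite for such $n$. -/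

import Mathlib

/-- A quasi-ordered set together with a norm function (only finitely many elements have norm
below any given bound). When the quasi-order is a well-quasi-order, this is a normed wqo. -/
structure NormedQO (A : Type*) where
  le : A → A → Prop
  refl : ∀ x, le x x
  trans : ∀ x y z, le x y → le y z → le x z
  norm : A → ℕ
  finite_norm_lt : ∀ n : ℕ, {x : A | norm x < n}.Finite

namespace NormedQO

/-- The natural numbers with the usual order and the identity as norm. -/
def nat : NormedQO ℕ where
  le x y := x ≤ y
  refl := le_refl
  trans _ _ _ := le_trans
  norm x := x
  finite_norm_lt n := Set.finite_lt_nat n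

/-- The `k`-fold cartesian product of a normed quasi-order with itself: componentwise order,
maximum of the norms of the components. -/
def power {A : Type*} (Q : NormedQO A) (k : ℕ) : NormedQO (Fin k → A) where
  le x y := ∀ i, Q.le (x i) (y i)
  refl x i := Q.refl (x i)
  trans x y z hxy hyz i := Q.trans (x i) (y i) (z i) (hxy i) (hyz i)
  norm x := Finset.univ.sup fun i => Q.norm (x i)
  finite_norm_lt n := by
    refine (Set.Finite.pi' (fun _ : Fin k => Q.finite_norm_lt n)).subset fun x hx i => ?_
    exact lt_of_le_of_lt (Finset.le_sup (f := fun i => Q.norm (x i)) (Finset.mem_univ i)) hx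

/-- The minoring ordering on the finite subsets of a normed quasi-order, with norm
`max ({|x| : x ∈ X} ∪ {card X})`. -/
def minoring {A : Type*} (Q : NormedQO A) : NormedQO (Finset A) where
  le X Y := ∀ y ∈ Y, ∃ x ∈ X, Q.le x y
  refl _ y hy := ⟨y, hy, Q.refl y⟩
  trans X Y Z hXY hYZ z hz := by
    obtain ⟨y, hy, hyz⟩ := hYZ z hz
    obtain ⟨x, hx, hxy⟩ := hXY y hy
    exact ⟨x, hx, Q.trans x y z hxy hyz⟩
  norm X := max (X.sup Q.norm) X.card
  finite_norm_lt n := by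
    refine ((Q.finite_norm_lt n).finite_subsets.preimage
      (Finset.coe_injective.injOn (s := Set.univ) |>.mono (Set.subset_univ _))).subset
      fun X hX x hx => ?_
    have h1 : Q.norm x ≤ X.sup Q.norm := Finset.le_sup (f := Q.norm) hx
    exact lt_of_le_of_lt (h1.trans (le_max_left _ _)) hX

/-- A finite sequence `x₀, …, x_{l-1}` is bad if there are no `i < j` with `x_i ≤ x_j`. -/
def IsBad {A : Type*} (Q : NormedQO A) {l : ℕ} (x : Fin l → A) : Prop :=
  ∀ i j : Fin l, i < j → ¬ Q.le (x i) (x j)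

/-- A finite sequence is `(g, n)`-controlled if `|x_i| ≤ g^i(n)` for all `i`. -/
def IsControlled {A : Type*} (Q : NormedQO A) (g : ℕ → ℕ) (n : ℕ) {l : ℕ} (x : Fin l → A) :
    Prop :=
  ∀ i : Fin l, Q.norm (x i) ≤ g^[i] n

/-- The length function: the supremum in `ℕ∞` of the lengths of `(g, n)`-controlled bad
sequences (it is `⊤` exactly when these lengths are unbounded, and the maximum otherwise). -/
noncomputable def lengthFunction {A : Type*} (Q : NormedQO A) (g : ℕ → ℕ) (n : ℕ) : ℕ∞ :=
  ⨆ (l : ℕ) (_ : ∃ x : Fin l → A, Q.IsControlled g n x ∧ Q.IsBad x), (l : ℕ∞)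

end NormedQO

/-- The predecessor `P_x(α)` of an ordinal `α > 0` in Cantor normal form, with respect to
Mathlib's fundamental sequences `(γ + ω^(β+1))(x) = γ + ω^β · (x+1)` and
`(γ + ω^μ)(x) = γ + ω^(μ(x))` for limit `μ`:
`P_x(α+1) = α` and `P_x(μ) = P_x(μ(x))`. (`P_x(0)` is set to `0` and never used.) -/
def predAt (x : ℕ) (o : ONote) : ONote :=
  match h : ONote.fundamentalSequence o with
  | Sum.inl none => 0
  | Sum.inl (some a) => a
  | Sum.inr f =>
    have : f x < o := by
      have H := ONote.fundamentalSequence_has_prop o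
      rw [h] at H
      exact (H.2.1 x).2.1
    predAt x (f x)
termination_by o

theorem predAt_lt (x : ℕ) (o : ONote) (ho : o ≠ 0) : predAt x o < o := by
  have H := ONote.fundamentalSequence_has_prop o
  rw [predAt]
  split
  · next h =>
    rw [h] at H
    exact absurd H ho
  · next a h =>
    rw [h] at H
    rw [ONote.lt_def, H.1]
    exact Order.lt_succ _
  · next f h =>
    rw [h] at H
    have hlt : f x < o := (H.2.1 x).2.1
    have hpos : f x ≠ 0 := by
      cases o with
      | zero => simp [ONote.fundamentalSequence] at h
      | oadd a m b =>
        simp only [ONote.fundamentalSequence] at h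
        split at h <;> try split at h
        all_goals first
          | (cases h; done)
          | (obtain rfl := Sum.inr.inj h; exact fun h0 => ONote.noConfusion h0)
    exact (predAt_lt x (f x) hpos).trans hlt
termination_by o

/-- The Cichon hierarchy of `h`, on ordinals below `ε₀` in Cantor normal form:
`h_0(x) = 0` and `h_α(x) = 1 + h_{P_x(α)}(h(x))` for `α > 0`. -/
def cichon (h : ℕ → ℕ) (o : ONote) (x : ℕ) : ℕ :=
  if ho : o = 0 then 0
  else
    have := predAt_lt x o ho
    1 + cichon h (predAt x o) (h x)
termination_by o

/-! Encode a tuple `X` of norm at most `M` by the downward closed set `avoiding X M`, spread over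
`2^d * k` copies of `ℕ^d`: the copy `(a, S)` holds the points with coordinates below `M` that stay
outside the upward closure of `X a` however the coordinates in `S` are changed. Thus `S` marks
coordinates that have become too large to matter. By `le_of_avoiding_subset`, inclusion of the codes
forces the minoring order, so a bad sequence gives down-sets with no earlier one inside a later one.

Such a sequence is followed by a finite family of cells containing all remaining sets. If `X` and a
later `Y` lie in one cell, `X ⊄ Y` gives a point `u` missing from `Y`; within its slice, `Y` is then
covered by slices of lower dimension, or is a known finite set when the dimension is one
(`exists_mem_child`). So the cell of the current set can be replaced by finitely many children. A
slice of dimension `e + 1` weighs `ω^e`, a cell `ω` to the natural sum of its slice weights, and a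
family the natural sum of its cell weights; each step lowers the last ordinal. It starts at `α`.

The control function bounds the number of slices and cells, hence the coefficients of these
ordinals. An ordinal below `o` with coefficients at most `x` is at most `P_x(o)` (`le_predAt`), so
the descent is no longer than the one defining the Cichon function. -/

namespace ONote

/-! ### Coefficients of notations and the predecessor `P_x` -/

/-- The largest coefficient that occurs in an ordinal notation, at any level of exponents. -/
def maxCoeff : ONote → ℕ
  | 0 => 0
  | oadd e n a => max e.maxCoeff (max (n : ℕ) a.maxCoeff)

theorem maxCoeff_oadd (e : ONote) (n : ℕ+) (a : ONote) :
    (oadd e n a).maxCoeff = max e.maxCoeff (max (n : ℕ) a.maxCoeff) := rfl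

theorem maxCoeff_ofNat (n : ℕ) : (ofNat n).maxCoeff = n := by
  cases n with
  | zero => rfl
  | succ n => simp [ofNat, maxCoeff_oadd, maxCoeff]

theorem lt_trichotomy_of_NF (a b : ONote) [NF a] [NF b] : a < b ∨ a = b ∨ b < a := by
  have h := cmp_compares a b
  cases hc : cmp a b <;> rw [hc] at h
  · exact Or.inl h
  · exact Or.inr (Or.inl h)
  · exact Or.inr (Or.inr h)

theorem le_iff_lt_or_eq_of_NF {a b : ONote} [NF a] [NF b] : a ≤ b ↔ a < b ∨ a = b := by
  rw [← repr_inj (a := a) (b := b)]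
  exact le_iff_lt_or_eq (a := a.repr)

theorem lt_of_oadd_lt_oadd {e e' a a' : ONote} {n n' : ℕ+} (h₁ : NF (oadd e n a))
    (h₂ : NF (oadd e' n' a')) (h : oadd e n a < oadd e' n' a') :
    e < e' ∨ e = e' ∧ ((n : ℕ) < n' ∨ n = n' ∧ a < a') := by
  have := h₁.fst
  have := h₂.fst
  have := h₁.snd
  have := h₂.snd
  rcases lt_trichotomy_of_NF e e' with he | rfl | he
  · exact Or.inl he
  · refine Or.inr ⟨rfl, ?_⟩
    rcases lt_trichotomy (n : ℕ) n' with hn | hn | hn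
    · exact Or.inl hn
    · obtain rfl := PNat.coe_injective hn
      refine Or.inr ⟨rfl, ?_⟩
      rcases lt_trichotomy_of_NF a a' with ha | rfl | ha
      · exact ha
      · exact absurd h (lt_irrefl _)
      · exact absurd h (oadd_lt_oadd_3 ha).asymm
    · exact absurd h (oadd_lt_oadd_2 h₂ hn).asymm
  · exact absurd h (oadd_lt_oadd_1 h₂ he).asymm

theorem not_lt_zero' (a : ONote) : ¬ a < 0 := by
  rw [lt_def]
  simp

/-- If every `ω^e` with `e < a` and bounded coefficients is below the tail `c`, then so is every
notation with leading exponent below `a` and bounded coefficients, also after adding `ω^a * m`. -/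
theorem lt_oadd_of_tail {a c o : ONote} {x : ℕ} [ho : NF o] {m : ℕ} [ha : NF a]
    (hc : ∀ b : ONote, NF b → NFBelow b a.repr → b.maxCoeff ≤ x → b < c)
    (h : o < oadd a (m + 1).succPNat 0) (hx : o.maxCoeff ≤ x) : o < oadd a m.succPNat c := by
  cases o with
  | zero => exact oadd_pos _ _ _
  | oadd e n r =>
    rw [maxCoeff_oadd] at hx
    rcases lt_of_oadd_lt_oadd ho inferInstance h with he | ⟨rfl, hn | ⟨-, hr⟩⟩
    · exact oadd_lt_oadd_1 ho he
    · rcases lt_or_eq_of_le (Nat.lt_succ_iff.1 (show (n : ℕ) < m.succ + 1 from hn)) with hn | hn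
      · exact oadd_lt_oadd_2 ho hn
      · obtain rfl : n = m.succPNat := PNat.coe_injective hn
        exact oadd_lt_oadd_3 (hc r ho.snd ho.snd' (by omega))
    · exact absurd hr (not_lt_zero' _)

/-- Only the last summand `ω^a` of `o` is changed, so the comparison reduces to notations below
`ω^a`; a limit exponent `a` is handled by recursion. -/
theorem lt_fundamentalSequence {x : ℕ} : ∀ {o : ONote} {f : ℕ → ONote} {b : ONote} [NF o] [NF b],
    fundamentalSequence o = Sum.inr f → b < o → b.maxCoeff ≤ x → b < f x
  | 0, f, b, _, _, h, _, _ => by simp [fundamentalSequence] at h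
  | oadd a m r, f, o, ho, hb, h, hlt, hx => by
    have ha := ho.fst
    have hr := ho.snd
    rw [fundamentalSequence] at h
    rcases er : r.fundamentalSequence with (⟨_ | r'⟩ | fr)
    · have hr0 := fundamentalSequence_has_prop r
      rw [er] at hr0
      obtain rfl : r = 0 := hr0
      rw [er] at h
      -- The last term is `ω^a * m`: for `m = 1` it becomes `c` alone, otherwise one copy of `ω^a`
      -- is split off and replaced by `c`.
      have key : ∀ c : ONote, (∀ b : ONote, NF b → NFBelow b a.repr → b.maxCoeff ≤ x → b < c) →
          (m.natPred = 0 → o < c) ∧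
          ∀ m', m.natPred = m' + 1 → o < oadd a m'.succPNat c := by
        refine fun c hc => ⟨fun hm => ?_, fun m' hm => ?_⟩
        · refine hc o hb (NF.below_of_lt' ?_ hb) hx
          have : m = 1 := by
            rw [← PNat.natPred_inj, hm]; rfl
          subst this
          simpa [lt_def] using! hlt
        · have : m = (m' + 1).succPNat := by
            rw [← PNat.natPred_inj, hm]; rfl
          subst this
          exact lt_oadd_of_tail hc hlt hx
      rcases ea : a.fundamentalSequence with (⟨_ | a'⟩ | fa)
      · rcases em : m.natPred with - | m' <;> rw [ea, em] at h <;> simp at h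
      · have hp := fundamentalSequence_has_prop a
        rw [ea] at hp
        have ha' : NF a' := hp.2 ha
        have hc : ∀ b : ONote, NF b → NFBelow b a.repr → b.maxCoeff ≤ x →
            b < oadd a' x.succPNat 0 := by
          intro b hb hba hbx
          cases b with
          | zero => exact oadd_pos _ _ _
          | oadd e n r =>
            rw [maxCoeff_oadd] at hbx
            have he := hb.fst
            have hle : e ≤ a' := Order.lt_succ_iff.1 (hp.1 ▸ hba.lt)
            rcases le_iff_lt_or_eq_of_NF.1 hle with hlt | rfl
            · exact oadd_lt_oadd_1 hb hlt
            -- A coefficient at most `x` is below the `x + 1` of the fundamental sequence.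
            · exact oadd_lt_oadd_2 hb (by simp; omega)
        rcases em : m.natPred with - | m' <;> rw [ea, em] at h <;>
          obtain rfl := Sum.inr.inj h
        · exact (key _ hc).1 em
        · exact (key _ hc).2 m' em
      · have hc : ∀ b : ONote, NF b → NFBelow b a.repr → b.maxCoeff ≤ x →
            b < oadd (fa x) 1 0 := by
          intro b hb hba hbx
          cases b with
          | zero => exact oadd_pos _ _ _
          | oadd e n r =>
            rw [maxCoeff_oadd] at hbx
            have he := hb.fst
            exact oadd_lt_oadd_1 hb (lt_fundamentalSequence ea hba.lt (by omega))
        rcases em : m.natPred with - | m' <;> rw [ea, em] at h <;>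
          obtain rfl := Sum.inr.inj h
        · exact (key _ hc).1 em
        · exact (key _ hc).2 m' em
    · rw [er] at h
      simp at h
    · rw [er] at h
      obtain rfl := Sum.inr.inj h
      cases o with
      | zero => exact oadd_pos _ _ _
      | oadd e n s =>
        rw [maxCoeff_oadd] at hx
        rcases lt_of_oadd_lt_oadd hb ho hlt with he | ⟨rfl, hn | ⟨rfl, hs⟩⟩
        · exact oadd_lt_oadd_1 hb he
        · exact oadd_lt_oadd_2 hb hn
        · have := hb.snd
          exact oadd_lt_oadd_3 (lt_fundamentalSequence er hs (by omega))

theorem NF_predAt (x : ℕ) (o : ONote) (ho : NF o) : NF (predAt x o) := by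
  have H := fundamentalSequence_has_prop o
  rw [predAt]
  split
  · infer_instance
  · next a h =>
    rw [h] at H
    exact H.2 ho
  · next f h =>
    rw [h] at H
    have := (H.2.1 x).2.1
    exact NF_predAt x (f x) ((H.2.1 x).2.2 ho)
termination_by o

/-- Each passage from a limit to its `x`-th element keeps `b` strictly below, and the final
successor step loses only one. This makes any monotonicity of the Cichon function in the ordinal
unnecessary. -/
theorem le_predAt {x : ℕ} (o b : ONote) (ho : NF o) (hb : NF b) (hlt : b < o)
    (hx : b.maxCoeff ≤ x) : b ≤ predAt x o := by
  have H := fundamentalSequence_has_prop o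
  rw [predAt]
  split
  · next h =>
    rw [h] at H
    obtain rfl : o = 0 := H
    exact absurd hlt (not_lt_zero' _)
  · next a h =>
    rw [h] at H
    rw [lt_def, H.1] at hlt
    exact Order.lt_succ_iff.1 hlt
  · next f h =>
    rw [h] at H
    have := (H.2.1 x).2.1
    exact le_predAt (f x) b ((H.2.1 x).2.2 ho) hb (lt_fundamentalSequence h hlt hx) hx
termination_by o

/-! ### Natural sums of powers of `ω` -/

/-- The natural sum of `ω ^ e` and an ordinal notation. -/
noncomputable def addOpow (e : ONote) : ONote → ONote
  | 0 => oadd e 1 0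
  | oadd a n b =>
    open Classical in
    if a < e then oadd e 1 (oadd a n b)
    else if e = a then oadd a (n + 1) b
    else oadd a n (addOpow e b)

theorem addOpow_zero (e : ONote) : addOpow e 0 = oadd e 1 0 := rfl

theorem addOpow_oadd_of_lt {e a : ONote} (h : a < e) (n : ℕ+) (b : ONote) :
    addOpow e (oadd a n b) = oadd e 1 (oadd a n b) := by
  rw [addOpow, if_pos h]

theorem addOpow_oadd_self (a : ONote) (n : ℕ+) (b : ONote) :
    addOpow a (oadd a n b) = oadd a (n + 1) b := by
  rw [addOpow, if_neg (lt_irrefl _), if_pos rfl]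

theorem addOpow_oadd_of_gt {e a : ONote} (h : e < a) (n : ℕ+) (b : ONote) :
    addOpow e (oadd a n b) = oadd a n (addOpow e b) := by
  rw [addOpow, if_neg h.asymm, if_neg (fun h' => (h' ▸ h).false)]

theorem nfBelow_addOpow {e : ONote} [he : NF e] {B : Ordinal} (heB : e.repr < B) :
    ∀ {o : ONote}, NFBelow o B → NFBelow (addOpow e o) B
  | 0, _ => NFBelow.oadd he NFBelow.zero heB
  | oadd a n b, ho => by
    have ha := ho.fst
    rcases lt_trichotomy_of_NF e a with h | rfl | h
    · rw [addOpow_oadd_of_gt h]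
      exact NFBelow.oadd ha (nfBelow_addOpow h ho.snd) ho.lt
    · rw [addOpow_oadd_self]
      exact NFBelow.oadd ha ho.snd ho.lt
    · rw [addOpow_oadd_of_lt h]
      exact NFBelow.oadd he (NF.below_of_lt h ⟨⟨_, ho⟩⟩) heB

theorem NF_addOpow {e o : ONote} (he : NF e) (ho : NF o) : NF (addOpow e o) := by
  obtain ⟨B, hB⟩ := ho.out
  exact ⟨⟨max (Order.succ e.repr) B, nfBelow_addOpow (by simp)
    (hB.mono (le_max_right _ _))⟩⟩

theorem maxCoeff_addOpow_le (e : ONote) :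
    ∀ o : ONote, (addOpow e o).maxCoeff ≤ max e.maxCoeff (o.maxCoeff + 1)
  | 0 => by simp [addOpow_zero, maxCoeff_oadd, maxCoeff]
  | oadd a n b => by
    have ih := maxCoeff_addOpow_le e b
    rw [addOpow]
    split_ifs with h h
    · simp only [maxCoeff_oadd, PNat.one_coe]
      omega
    · simp only [maxCoeff_oadd, PNat.add_coe, PNat.one_coe]
      omega
    · simp only [maxCoeff_oadd]
      omega

theorem addOpow_left_comm {e e' : ONote} [he : NF e] [he' : NF e'] :
    ∀ {o : ONote}, NF o → addOpow e (addOpow e' o) = addOpow e' (addOpow e o)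
  | 0, _ => by
    rcases lt_trichotomy_of_NF e e' with h | rfl | h
    · simp [addOpow_zero, addOpow_oadd_of_gt h, addOpow_oadd_of_lt h]
    · rfl
    · simp [addOpow_zero, addOpow_oadd_of_gt h, addOpow_oadd_of_lt h]
  | oadd a n b, ho => by
    have ha := ho.fst
    have ih := addOpow_left_comm (e := e) (e' := e') ho.snd
    rcases lt_trichotomy_of_NF e e' with h | h | h
    · rcases lt_trichotomy_of_NF e a with h1 | h1 | h1
      · rcases lt_trichotomy_of_NF e' a with h2 | rfl | h2 <;>
        simp [addOpow_oadd_of_gt, addOpow_oadd_of_lt, addOpow_oadd_self, *]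
      · subst h1
        simp [addOpow_oadd_of_lt, addOpow_oadd_of_gt, addOpow_oadd_self, h]
      · simp [addOpow_oadd_of_lt, addOpow_oadd_of_gt, h, h1, h1.trans h]
    · rw [h]
    · rcases lt_trichotomy_of_NF e' a with h1 | h1 | h1
      · rcases lt_trichotomy_of_NF e a with h2 | rfl | h2 <;>
        simp [addOpow_oadd_of_gt, addOpow_oadd_of_lt, addOpow_oadd_self, *]
      · subst h1
        simp [addOpow_oadd_of_lt, addOpow_oadd_of_gt, addOpow_oadd_self, h]
      · simp [addOpow_oadd_of_lt, addOpow_oadd_of_gt, h, h1, h1.trans h]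

theorem nfBelow_foldr_addOpow {o : ONote} {B : Ordinal} (ho : NFBelow o B) :
    ∀ {l : List ONote}, (∀ e ∈ l, NF e ∧ e.repr < B) → NFBelow (l.foldr addOpow o) B
  | [], _ => ho
  | e :: l, h => by
    have := (h e (by simp)).1
    exact nfBelow_addOpow (h e (by simp)).2
      (nfBelow_foldr_addOpow ho fun e' he' => h e' (by simp [he']))

theorem foldr_addOpow_oadd {a : ONote} (n : ℕ+) (b : ONote) :
    ∀ {l : List ONote}, (∀ e ∈ l, e < a) →
      l.foldr addOpow (oadd a n b) = oadd a n (l.foldr addOpow b)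
  | [], _ => rfl
  | e :: l, h => by
    rw [List.foldr_cons, List.foldr_cons, foldr_addOpow_oadd n b fun e' he' => h e' (by simp [he']),
      addOpow_oadd_of_gt (h e (by simp))]

/-- Terms of `o` with exponent above `e` agree on both sides. At exponent `e` the right side gains
one `ω^e`, while everything added on the left stays below `ω^e`. -/
theorem foldr_addOpow_lt {e : ONote} [he : NF e] {l : List ONote} (hl : ∀ e' ∈ l, NF e' ∧ e' < e) :
    ∀ {o : ONote}, NF o → l.foldr addOpow o < addOpow e o
  | 0, _ => by
    have h := nfBelow_foldr_addOpow (NFBelow.zero (b := e.repr)) hl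
    rw [addOpow_zero, lt_def]
    simpa using h.repr_lt
  | oadd a n b, ho => by
    have ha := ho.fst
    have hb := ho.snd
    rcases lt_trichotomy_of_NF e a with h | rfl | h
    · rw [foldr_addOpow_oadd n b fun e' he' => (hl e' he').2.trans h, addOpow_oadd_of_gt h]
      exact oadd_lt_oadd_3 (foldr_addOpow_lt hl hb)
    · rw [foldr_addOpow_oadd n b fun e' he' => (hl e' he').2, addOpow_oadd_self]
      refine oadd_lt_oadd_2 (NF.oadd he n (nfBelow_foldr_addOpow ho.snd' hl)) ?_
      simp
    · rw [addOpow_oadd_of_lt h]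
      have hlt := (nfBelow_foldr_addOpow (NF.below_of_lt h ho) hl).repr_lt
      exact hlt.trans_le (omega0_le_oadd e 1 _)

end ONote

namespace NONote

/-- The natural sum of `ω ^ e` and an ordinal notation. -/
noncomputable def addOpow (e o : NONote) : NONote :=
  ⟨ONote.addOpow e.1 o.1, ONote.NF_addOpow e.2 o.2⟩

instance : LeftCommutative addOpow where
  left_comm e e' o := Subtype.ext (ONote.addOpow_left_comm (he := e.2) (he' := e'.2) o.2)

/-- The natural sum of the ordinals `ω ^ e` for `e` in a multiset. -/
noncomputable def opowSum (s : Multiset NONote) : NONote := s.foldr addOpow 0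

theorem val_foldr_addOpow (o : NONote) (l : List NONote) :
    (l.foldr addOpow o).1 = (l.map Subtype.val).foldr ONote.addOpow o.1 := by
  induction l with
  | nil => rfl
  | cons e l ih => exact congrArg (ONote.addOpow e.1) ih

theorem opowSum_cons (e : NONote) (s : Multiset NONote) :
    opowSum (e ::ₘ s) = addOpow e (opowSum s) :=
  Multiset.foldr_cons _ _ _ _

/-- Replacing an exponent by finitely many smaller ones makes the natural sum smaller. -/
theorem opowSum_add_lt {s t : Multiset NONote} {e : NONote} (h : ∀ e' ∈ s, e' < e) :
    opowSum (s + t) < opowSum (e ::ₘ t) := by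
  rw [opowSum_cons, opowSum, Multiset.foldr_add]
  induction s using Quotient.inductionOn with
  | h l =>
    change (⟨_, _⟩ : {o : ONote // o.NF}) < (_ : NONote)
    change (List.foldr addOpow (opowSum t) l).1 < ONote.addOpow e.1 (opowSum t).1
    rw [val_foldr_addOpow]
    refine ONote.foldr_addOpow_lt (he := e.2) ?_ (opowSum t).2
    intro e' he'
    obtain ⟨e'', hm, rfl⟩ := List.mem_map.1 he'
    exact ⟨e''.2, h e'' hm⟩

theorem maxCoeff_opowSum_le {N : ℕ} (s : Multiset NONote) (h : ∀ e ∈ s, e.1.maxCoeff ≤ N) :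
    (opowSum s).1.maxCoeff ≤ N + Multiset.card s := by
  induction s using Multiset.induction_on with
  | empty => exact Nat.zero_le _
  | cons e s ih =>
    rw [opowSum_cons, Multiset.card_cons]
    have h1 := ih fun e' he' => h e' (Multiset.mem_cons_of_mem he')
    have h2 := h e (Multiset.mem_cons_self _ _)
    have h3 : (addOpow e (opowSum s)).1.maxCoeff ≤ _ := ONote.maxCoeff_addOpow_le e.1 (opowSum s).1
    omega

theorem repr_opowSum_replicate (e : NONote) (n : ℕ) :
    (opowSum (Multiset.replicate n e)).repr = Ordinal.omega0 ^ e.repr * n := by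
  have key : ∀ n : ℕ, (opowSum (Multiset.replicate (n + 1) e)).1 = ONote.oadd e.1 n.succPNat 0 := by
    intro n
    induction n with
    | zero => rfl
    | succ n ih =>
      rw [Multiset.replicate_succ, opowSum_cons]
      change ONote.addOpow e.1 (opowSum _).1 = _
      rw [ih, ONote.addOpow_oadd_self]
      rfl
  cases n with
  | zero => simp [opowSum, repr]; rfl
  | succ n => rw [repr, key, ONote.repr]; simp [repr]

end NONote

theorem succ_le_cichon {h : ℕ → ℕ} {o : ONote} {x l : ℕ} (ho : o ≠ 0)
    (hl : l ≤ cichon h (predAt x o) (h x)) : l + 1 ≤ cichon h o x := by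
  rw [cichon, dif_neg ho]
  dsimp only
  omega

/-! ### Slices, cells and their refinement -/

section Cells

open Classical

/-- A slice of `ι × ℕ^d`: a component together with fixed values for the coordinates that are
not free. -/
structure Slice (ι : Type*) (d : ℕ) where
  comp : ι
  free : Finset (Fin d)
  base : Fin d → ℕ

namespace Slice

variable {ι : Type*} {d : ℕ}

/-- The set of points of a slice. -/
def points (σ : Slice ι d) : Set (ι × (Fin d → ℕ)) :=
  {w | w.1 = σ.comp ∧ ∀ i ∉ σ.free, w.2 i = σ.base i}

/-- The exponent of a slice: its dimension minus one. -/
def exponent (σ : Slice ι d) : NONote := NONote.ofNat (σ.free.card - 1)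

/-- The slice in which the free coordinate `i` is fixed to be `a`. -/
def fix (σ : Slice ι d) (i : Fin d) (a : ℕ) : Slice ι d :=
  ⟨σ.comp, σ.free.erase i, Function.update σ.base i a⟩

theorem mem_points_fix {σ : Slice ι d} {w : ι × (Fin d → ℕ)} (hw : w ∈ σ.points) (i : Fin d) :
    w ∈ (σ.fix i (w.2 i)).points := by
  refine ⟨hw.1, fun j hj => ?_⟩
  by_cases hji : j = i
  · subst hji
    simp [fix]
  · simp only [fix, Finset.mem_erase, not_and, Function.update_of_ne hji] at hj ⊢
    exact hw.2 j (hj hji)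

/-- The slices of dimension one less that cover the points of a slice not above `u`. -/
def refine (σ : Slice ι d) (u : Fin d → ℕ) : Multiset (Slice ι d) :=
  -- In dimension one no slice remains: the points not above `u` are those below it, and
  -- `Cell.child` puts them in the core.
  if 2 ≤ σ.free.card then
    σ.free.val.bind fun i => (Multiset.range (u i)).map fun a => σ.fix i a
  else 0

theorem card_free_of_mem_refine {σ τ : Slice ι d} {u : Fin d → ℕ} (h : τ ∈ σ.refine u) :
    τ.free.card + 1 = σ.free.card ∧ 1 ≤ τ.free.card := by
  unfold refine at h
  split_ifs at h with h2
  · obtain ⟨i, hi, h⟩ := Multiset.mem_bind.1 h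
    obtain ⟨a, -, rfl⟩ := Multiset.mem_map.1 h
    have := Finset.card_erase_of_mem (s := σ.free) (a := i) hi
    simp only [fix]
    omega
  · simp at h

theorem card_refine_le {σ : Slice ι d} {u : Fin d → ℕ} {n : ℕ} (hu : ∀ i, u i < n) :
    Multiset.card (σ.refine u) ≤ d * n := by
  unfold refine
  split_ifs
  · rw [Multiset.card_bind]
    calc _ ≤ (σ.free.val.map fun _ => n).sum := by
          refine Multiset.sum_map_le_sum_map _ _ fun i _ => ?_
          simpa using (hu i).le
      _ = σ.free.card * n := by simp
      _ ≤ d * n := Nat.mul_le_mul_right _ (by simpa using Finset.card_le_univ σ.free)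
  · simp

theorem exponent_lt_of_mem_refine {σ τ : Slice ι d} {u : Fin d → ℕ} (h : τ ∈ σ.refine u) :
    τ.exponent < σ.exponent := by
  have := card_free_of_mem_refine h
  change (ONote.ofNat _).repr < (ONote.ofNat _).repr
  rw [ONote.repr_ofNat, ONote.repr_ofNat, Nat.cast_lt]
  omega

theorem maxCoeff_exponent_le (σ : Slice ι d) : σ.exponent.1.maxCoeff ≤ d := by
  change (ONote.ofNat _).maxCoeff ≤ d
  rw [ONote.maxCoeff_ofNat]
  have : σ.free.card ≤ d := by simpa using Finset.card_le_univ σ.free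
  omega

end Slice

/-- A cell: the sets that contain `core` and are covered by `core` and the slices. -/
structure Cell (ι : Type*) (d : ℕ) where
  slices : Multiset (Slice ι d)
  core : Set (ι × (Fin d → ℕ))

namespace Cell

variable {ι : Type*} {d : ℕ}

/-- The sets that belong to a cell. -/
def Mem (Y : Set (ι × (Fin d → ℕ))) (C : Cell ι d) : Prop :=
  C.core ⊆ Y ∧ ∀ w ∈ Y, w ∈ C.core ∨ ∃ σ ∈ C.slices, w ∈ σ.points

/-- The exponent of a cell: the natural sum of the `ω ^ σ.exponent` over its slices. -/
noncomputable def exponent (C : Cell ι d) : NONote :=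
  NONote.opowSum (C.slices.map Slice.exponent)

/-- The part of a cell made of the sets that contain the points of `σ` strictly below `u` but not
`u` itself. -/
noncomputable def child (C : Cell ι d) (σ : Slice ι d) (u : Fin d → ℕ) : Cell ι d :=
  ⟨σ.refine u + C.slices.erase σ, C.core ∪ {w | w ∈ σ.points ∧ w.2 < u}⟩

/-- The points of `ℕ^d` with all coordinates below `n`. -/
def box (d n : ℕ) : Finset (Fin d → ℕ) := Fintype.piFinset fun _ => Finset.range n

theorem mem_box {n : ℕ} {u : Fin d → ℕ} : u ∈ box d n ↔ ∀ i, u i < n := by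
  simp [box]

/-- All children of a cell for points with coordinates below `n`. -/
noncomputable def children (C : Cell ι d) (n : ℕ) : Multiset (Cell ι d) :=
  C.slices.bind fun σ => (box d n).val.map fun u => C.child σ u

theorem mem_children {C C' : Cell ι d} {n : ℕ} :
    C' ∈ C.children n ↔ ∃ σ ∈ C.slices, ∃ u, (∀ i, u i < n) ∧ C.child σ u = C' := by
  simp [children, mem_box]

theorem card_children (C : Cell ι d) (n : ℕ) :
    Multiset.card (C.children n) = Multiset.card C.slices * n ^ d := by
  simp [children, box, Multiset.card_bind]

theorem card_slices_child_le {C : Cell ι d} {σ : Slice ι d} {u : Fin d → ℕ} {n : ℕ}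
    (hu : ∀ i, u i < n) :
    Multiset.card (C.child σ u).slices ≤ Multiset.card C.slices + d * n := by
  have h1 := Slice.card_refine_le (σ := σ) hu
  have h2 := Multiset.card_le_card (Multiset.erase_le σ C.slices)
  simp only [child, Multiset.card_add]
  omega

theorem exponent_child_lt {C : Cell ι d} {σ : Slice ι d} (hσ : σ ∈ C.slices) (u : Fin d → ℕ) :
    (C.child σ u).exponent < C.exponent := by
  unfold exponent
  conv_rhs => rw [← Multiset.cons_erase hσ]
  rw [Multiset.map_cons, child, Multiset.map_add]
  refine NONote.opowSum_add_lt fun e he => ?_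
  obtain ⟨τ, hτ, rfl⟩ := Multiset.mem_map.1 he
  exact Slice.exponent_lt_of_mem_refine hτ

theorem maxCoeff_exponent_le (C : Cell ι d) :
    C.exponent.1.maxCoeff ≤ d + Multiset.card C.slices := by
  refine (NONote.maxCoeff_opowSum_le (N := d) _ fun e he => ?_).trans_eq (by simp)
  obtain ⟨τ, -, rfl⟩ := Multiset.mem_map.1 he
  exact τ.maxCoeff_exponent_le

/-- A set of points is closed downwards in each component. -/
def IsDown (Y : Set (ι × (Fin d → ℕ))) : Prop :=
  ∀ p u v, v ≤ u → (p, u) ∈ Y → (p, v) ∈ Y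

/-- Minimality of the missing point determines the part of the slice strictly below it, and downward
closure excludes everything above it. -/
theorem exists_mem_child {C : Cell ι d} {X Y : Set (ι × (Fin d → ℕ))} {n : ℕ}
    (hC : ∀ σ ∈ C.slices, 1 ≤ σ.free.card) (hX : IsDown X) (hXn : ∀ w ∈ X, ∀ i, w.2 i < n)
    (hY : IsDown Y) (hXC : Mem X C) (hYC : Mem Y C) (hXY : ¬ X ⊆ Y) :
    ∃ C' ∈ C.children n, Mem Y C' := by
  obtain ⟨⟨p, u₀⟩, hu₀X, hu₀Y⟩ := Set.not_subset.1 hXY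
  obtain ⟨σ, hσ, hu₀σ⟩ := (hXC.2 _ hu₀X).resolve_left fun h => hu₀Y (hYC.1 h)
  -- Points of the slice strictly below a minimal such `u` lie in `X`, hence in `Y`; they may join
  -- the core.
  obtain ⟨u, ⟨huX, huσ, huY⟩, hmin⟩ := wellFounded_lt.has_min
    {u : Fin d → ℕ | (p, u) ∈ X ∧ (p, u) ∈ σ.points ∧ (p, u) ∉ Y} ⟨u₀, hu₀X, hu₀σ, hu₀Y⟩
  refine ⟨C.child σ u, mem_children.2 ⟨σ, hσ, u, hXn _ huX, rfl⟩, ?_, ?_⟩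
  · rintro ⟨q, v⟩ (hv | ⟨hv, hvu⟩)
    · exact hYC.1 hv
    · obtain rfl : q = p := hv.1.trans huσ.1.symm
      by_contra hvY
      exact hmin v ⟨hX _ _ _ hvu.le huX, hv, hvY⟩ hvu
  · rintro ⟨q, v⟩ hv
    rcases hYC.2 _ hv with hvR | ⟨τ, hτ, hvτ⟩
    · exact Or.inl (Or.inl hvR)
    · by_cases hτσ : τ = σ
      · subst hτσ
        obtain rfl : q = p := hvτ.1.trans huσ.1.symm
        have hnle : ¬ u ≤ v := fun h => huY (hY _ _ _ h hv)
        obtain ⟨i, hi⟩ : ∃ i, v i < u i := by simpa [Pi.le_def] using hnle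
        -- Off the free coordinates `u` and `v` both equal the base of the slice, so they can only
        -- differ at a free one.
        have hif : i ∈ τ.free := by
          by_contra hif
          have h1 := hvτ.2 i hif
          have h2 := huσ.2 i hif
          simp only at h1 h2
          omega
        by_cases h2 : 2 ≤ τ.free.card
        · refine Or.inr ⟨τ.fix i (v i), ?_, Slice.mem_points_fix hvτ i⟩
          refine Multiset.mem_add.2 (Or.inl ?_)
          rw [Slice.refine, if_pos h2]
          exact Multiset.mem_bind.2 ⟨i, hif, Multiset.mem_map.2 ⟨v i, by simpa using hi, rfl⟩⟩
        · refine Or.inl (Or.inr ⟨hvτ, ?_⟩)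
          have h1 : τ.free = {i} := by
            obtain ⟨j, hj⟩ := Finset.card_eq_one.1 (le_antisymm (by omega) (hC τ hτ))
            rw [hj, Finset.mem_singleton] at hif
            rw [hj, hif]
          refine Pi.lt_def.2 ⟨fun j => ?_, i, hi⟩
          by_cases hji : j = i
          · exact hji ▸ hi.le
          · have hj : j ∉ τ.free := by simpa [h1] using hji
            exact ((hvτ.2 j hj).trans (huσ.2 j hj).symm).le
      · exact Or.inr ⟨τ, Multiset.mem_add.2 (Or.inr ((Multiset.mem_erase_of_ne hτσ).2 hτ)), hvτ⟩

/-! ### Descent of the ordinal of a family of cells -/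

/-- The ordinal of a finite family of cells. -/
noncomputable def ordinal (s : Multiset (Cell ι d)) : NONote :=
  NONote.opowSum (s.map exponent)

theorem ordinal_lt {s : Multiset (Cell ι d)} {C : Cell ι d} (hC : C ∈ s) (n : ℕ) :
    ordinal (C.children n + s.erase C) < ordinal s := by
  unfold ordinal
  conv_rhs => rw [← Multiset.cons_erase hC]
  rw [Multiset.map_cons, Multiset.map_add]
  refine NONote.opowSum_add_lt fun e he => ?_
  obtain ⟨C', hC', rfl⟩ := Multiset.mem_map.1 he
  obtain ⟨σ, hσ, u, -, rfl⟩ := mem_children.1 hC'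
  exact exponent_child_lt hσ u

theorem maxCoeff_ordinal_le {s : Multiset (Cell ι d)} {A : ℕ}
    (h : ∀ C ∈ s, Multiset.card C.slices ≤ A) :
    (ordinal s).1.maxCoeff ≤ d + A + Multiset.card s := by
  refine (NONote.maxCoeff_opowSum_le (N := d + A) _ fun e he => ?_).trans_eq (by simp)
  obtain ⟨C, hC, rfl⟩ := Multiset.mem_map.1 he
  exact C.maxCoeff_exponent_le.trans (Nat.add_le_add_left (h C hC) d)

theorem one_add_mul_le_add_one_pow (a d : ℕ) : 1 + d * a ≤ (a + 1) ^ d := by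
  induction d with
  | zero => simp
  | succ d ih =>
    rw [pow_succ]
    nlinarith [Nat.mul_le_mul_right (a + 1) ih, Nat.zero_le (d * a * a)]

/-- With at most `A` slices per cell and `B` cells, one step gives at most `A + d * n` and `B + A *
n ^ d`. The new sum is at most `x + d * g x + x * q` with `q = (g x + 1) ^ d`, and each summand is
at most `x * q`. -/
theorem control_step {d k n A B x : ℕ} (hd : 1 ≤ d) (hk : 1 ≤ k) {g : ℕ → ℕ} (hg : Monotone g)
    (hn : n ≤ x) (h : d + (A + d * n) + (B + A * n ^ d) ≤ x) :
    g n ≤ 4 * k * x * (g x + 1) ^ d ∧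
      d + ((A + d * n) + d * g n) + ((B + A * n ^ d) + (A + d * n) * g n ^ d) ≤
        4 * k * x * (g x + 1) ^ d := by
  have hgx : g n ≤ g x := hg hn
  have hx : 1 ≤ x := by omega
  have h1 : 1 + d * g x ≤ (g x + 1) ^ d := one_add_mul_le_add_one_pow (g x) d
  have h2 : g n ^ d ≤ (g x + 1) ^ d := Nat.pow_le_pow_left (by omega) d
  have h3 : g x ≤ d * g x := Nat.le_mul_of_pos_left _ hd
  have h4 : 4 * 1 * x * (g x + 1) ^ d ≤ 4 * k * x * (g x + 1) ^ d := by gcongr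
  have h5 : 1 * (g x + 1) ^ d ≤ x * (g x + 1) ^ d := by gcongr
  have h6 : (A + d * n) * g n ^ d ≤ x * (g x + 1) ^ d := by
    gcongr
    omega
  have h7 : d * g n ≤ d * g x := by gcongr
  have h8 : x * 1 ≤ x * (g x + 1) ^ d := Nat.mul_le_mul_left x (by omega)
  constructor
  · linarith
  · linarith

/-- The bound on the length of controlled bad sequences of downward closed sets. -/
theorem length_le_cichon {k : ℕ} (hd : 1 ≤ d) (hk : 1 ≤ k) {g : ℕ → ℕ} (hg : Monotone g)
    (l : ℕ) : ∀ (Y : ℕ → Set (ι × (Fin d → ℕ))) (n A B x : ℕ)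
    (s : Multiset (Cell ι d)) (o : ONote) (_ : o.NF),
    (∀ i < l, IsDown (Y i)) → (∀ i < l, ∀ w ∈ Y i, ∀ j, w.2 j < g^[i] n) →
    (∀ i j, i < j → j < l → ¬ Y i ⊆ Y j) →
    (∀ C ∈ s, Multiset.card C.slices ≤ A ∧ ∀ σ ∈ C.slices, 1 ≤ σ.free.card) →
    Multiset.card s ≤ B → (∀ i < l, ∃ C ∈ s, Mem (Y i) C) →
    n ≤ x → d + (A + d * n) + (B + A * n ^ d) ≤ x → (ordinal s).1 ≤ o →
    l ≤ cichon (fun x => 4 * k * x * (g x + 1) ^ d) o x := by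
  induction l with
  | zero => exact fun _ _ _ _ _ _ _ _ _ _ _ _ _ _ _ _ _ => Nat.zero_le _
  | succ l ih =>
    intro Y n A B x s o ho hdown hctrl hbad hs hB hmem hn hx hso
    obtain ⟨C, hC, hYC⟩ := hmem 0 (by omega)
    have hcard := Multiset.card_erase_add_one hC
    have hs' : ∀ C' ∈ C.children n + s.erase C, Multiset.card C'.slices ≤ A + d * n ∧
        ∀ σ ∈ C'.slices, 1 ≤ σ.free.card := by
      intro C' hC'
      rcases Multiset.mem_add.1 hC' with hC' | hC'
      · obtain ⟨σ, hσ, u, hu, rfl⟩ := mem_children.1 hC'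
        refine ⟨(card_slices_child_le hu).trans (Nat.add_le_add_right (hs C hC).1 _), ?_⟩
        intro τ hτ
        rcases Multiset.mem_add.1 hτ with hτ | hτ
        · exact (Slice.card_free_of_mem_refine hτ).2
        · exact (hs C hC).2 τ (Multiset.mem_of_mem_erase hτ)
      · have := hs C' (Multiset.mem_of_mem_erase hC')
        exact ⟨this.1.trans (Nat.le_add_right _ _), this.2⟩
    have hB' : Multiset.card (C.children n + s.erase C) ≤ B + A * n ^ d := by
      rw [Multiset.card_add, card_children]
      have : Multiset.card C.slices * n ^ d ≤ A * n ^ d := by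
        gcongr
        exact (hs C hC).1
      omega
    -- Only `ordinal s ≤ o` is maintained: `o` runs through iterated predecessors, while the ordinal
    -- of the family may drop faster.
    have hlt : (ordinal (C.children n + s.erase C)).1 < o :=
      lt_of_lt_of_le (b := (ordinal s).1) (ordinal_lt hC n) hso
    have hle := ONote.le_predAt o _ ho (ordinal (C.children n + s.erase C)).2 hlt
      ((maxCoeff_ordinal_le fun C' hC' => (hs' C' hC').1).trans
        ((Nat.add_le_add_left hB' _).trans hx))
    have hne : o ≠ 0 := fun h => ONote.not_lt_zero' _ (h ▸ hlt)
    obtain ⟨hgx, hx'⟩ := control_step hd hk hg hn hx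
    refine succ_le_cichon hne (ih (fun i => Y (i + 1)) (g n) (A + d * n) (B + A * n ^ d) _
      (C.children n + s.erase C) _ (ONote.NF_predAt x o ho) (fun i hi => hdown _ (by omega))
      (fun i hi => hctrl (i + 1) (by omega)) (fun i j hij hj => hbad _ _ (by omega) (by omega))
      hs' hB' ?_ hgx hx' hle)
    intro i hi
    obtain ⟨C₁, hC₁, hYC₁⟩ := hmem (i + 1) (by omega)
    -- Only sets that share the cell of `Y 0` need a new one; the other cells survive unchanged.
    by_cases hCC : C₁ = C
    · subst hCC
      obtain ⟨C', hC', hYC'⟩ := exists_mem_child (hs C₁ hC).2 (hdown 0 (by omega))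
        (hctrl 0 (by omega)) (hdown (i + 1) (by omega)) hYC hYC₁ (hbad 0 (i + 1) (by omega)
          (by omega))
      exact ⟨C', Multiset.mem_add.2 (Or.inl hC'), hYC'⟩
    · exact ⟨C₁, Multiset.mem_add.2 (Or.inr ((Multiset.mem_erase_of_ne hCC).2 hC₁)), hYC₁⟩

end Cell

end Cells

/-! ### Coding tuples of finite sets by downward closed sets -/

namespace NormedQO

/-- The points with coordinates below `M`, tagged with a component and a set `S` of coordinates,
for which no change of the coordinates in `S` leads above an element of the given finite sets. -/
def avoiding {d k : ℕ} (X : Fin k → Finset (Fin d → ℕ)) (M : ℕ) :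
    Set ((Fin k × Finset (Fin d)) × (Fin d → ℕ)) :=
  {w | (∀ j, w.2 j < M) ∧
    ∀ v : Fin d → ℕ, (∀ j ∉ w.1.2, v j = w.2 j) → ∀ x ∈ X w.1.1, ¬ x ≤ v}

open Classical in
theorem isDown_avoiding {d k : ℕ} (X : Fin k → Finset (Fin d → ℕ)) (M : ℕ) :
    Cell.IsDown (avoiding X M) := by
  rintro ⟨a, S⟩ u v hvu ⟨hu, hX⟩
  refine ⟨fun j => (hvu j).trans_lt (hu j), fun v' hv' x hx hxv => ?_⟩
  -- Keep `v'` on `S` and raise it to `u` elsewhere: the result still lies above `x` and is excluded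
  -- by `u`.
  refine hX (fun j => if j ∈ S then v' j else u j) (fun j hj => if_neg hj) x hx fun j => ?_
  dsimp only
  split_ifs with hj
  · exact hxv j
  · exact (hxv j).trans ((hv' j hj).le.trans (hvu j))

open Classical in
theorem le_of_avoiding_subset {d k M M' : ℕ} {X X' : Fin k → Finset (Fin d → ℕ)} (hM : 0 < M)
    (hX : (((nat.power d).minoring).power k).norm X ≤ M) (h : avoiding X M ⊆ avoiding X' M') :
    (((nat.power d).minoring).power k).le X X' := by
  intro a y hy
  by_contra hcon
  have hno : ∀ x ∈ X a, ¬ x ≤ y := fun x hx hxy => hcon ⟨x, hx, hxy⟩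
  have hnorm : ∀ x ∈ X a, ∀ j, x j ≤ M := fun x hx j =>
    calc x j ≤ (nat.power d).norm x :=
          Finset.le_sup (f := fun j => nat.norm (x j)) (Finset.mem_univ j)
      _ ≤ (nat.power d).minoring.norm (X a) :=
          (Finset.le_sup (f := (nat.power d).norm) hx).trans (le_max_left _ _)
      _ ≤ _ := Finset.le_sup (f := fun a => (nat.power d).minoring.norm (X a)) (Finset.mem_univ a)
      _ ≤ M := hX
  -- Coordinates of `y` that reach `M` are recorded in `S` and reset to `0`. Restoring them is
  -- harmless: elements of `X a` have coordinates at most `M`, so they cannot tell such coordinates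
  -- apart.
  have hmem : ((a, Finset.univ.filter fun j => M ≤ y j), fun j => if M ≤ y j then 0 else y j) ∈
      avoiding X M := by
    refine ⟨fun j => ?_, fun v hv x hx hxv => hno x hx fun j => ?_⟩
    · dsimp only
      split_ifs with hj
      · exact hM
      · exact not_le.1 hj
    · by_cases hj : M ≤ y j
      · exact (hnorm x hx j).trans hj
      · have := hv j (by simpa using hj)
        dsimp only at this
        rw [if_neg hj] at this
        exact (hxv j).trans this.le
  -- If the coded point also avoided `X'`, then so would `y`, which arises from it by changes in
  -- `S`; but `y` is an element of `X' a`.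
  refine (h hmem).2 y (fun j hj => ?_) y hy le_rfl
  dsimp only
  rw [if_neg (by simpa using hj)]

end NormedQO

/-! ### The initial cell and the final bound -/

/-- The cell of all sets of points. -/
def Cell.top (ι : Type*) [Fintype ι] (d : ℕ) : Cell ι d :=
  ⟨Finset.univ.val.map fun p : ι => ⟨p, Finset.univ, 0⟩, ∅⟩

theorem Cell.mem_top {ι : Type*} [Fintype ι] {d : ℕ} (Y : Set (ι × (Fin d → ℕ))) :
    Cell.Mem Y (Cell.top ι d) :=
  ⟨Set.empty_subset _, fun w _ => Or.inr ⟨⟨w.1, Finset.univ, 0⟩,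
    Multiset.mem_map.2 ⟨w.1, Finset.mem_univ _, rfl⟩, rfl, fun i hi => absurd (Finset.mem_univ i) hi⟩⟩

theorem Cell.repr_ordinal_top (ι : Type*) [Fintype ι] (d : ℕ) :
    (Cell.ordinal {Cell.top ι d}).repr =
      Ordinal.omega0 ^ (Ordinal.omega0 ^ ((d - 1 : ℕ) : Ordinal.{0}) * (Fintype.card ι : ℕ)) := by
  have h1 : (Cell.top ι d).exponent =
      NONote.opowSum (Multiset.replicate (Fintype.card ι) (NONote.ofNat (d - 1))) := by
    simp [Cell.exponent, Cell.top, Slice.exponent, Function.comp_def, Multiset.map_const']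
  have h2 : Cell.ordinal {Cell.top ι d} =
      NONote.opowSum (Multiset.replicate 1 (Cell.top ι d).exponent) := by
    simp [Cell.ordinal]
  rw [h2, NONote.repr_opowSum_replicate, h1, NONote.repr_opowSum_replicate]
  have h3 : (NONote.ofNat (d - 1)).repr = ((d - 1 : ℕ) : Ordinal.{0}) := ONote.repr_ofNat _
  rw [h3]
  simp

theorem control_start {d m n G : ℕ} (hn : 1 ≤ n) (hd : 1 ≤ d) (hG : n ≤ G) :
    n ≤ (2 * d + 2 * m + 1) * G ^ (2 * d) ∧
      d + (m + d * n) + (1 + m * n ^ d) ≤ (2 * d + 2 * m + 1) * G ^ (2 * d) := by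
  have h1 : n ^ d ≤ G ^ (2 * d) :=
    (Nat.pow_le_pow_right hn (by omega)).trans (Nat.pow_le_pow_left hG _)
  have h2 : n ≤ n ^ d := Nat.le_self_pow (by omega) n
  have h3 : d * n ≤ d * G ^ (2 * d) := Nat.mul_le_mul_left d (h2.trans h1)
  have h4 : m * n ^ d ≤ m * G ^ (2 * d) := Nat.mul_le_mul_left m h1
  have h5 : 1 ≤ G ^ (2 * d) := hn.trans (h2.trans h1)
  have h6 : (d + m) * 1 ≤ (d + m) * G ^ (2 * d) := Nat.mul_le_mul_left _ h5
  constructor <;> nlinarith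

theorem one_le_cichon (h : ℕ → ℕ) {o : ONote} (ho : o ≠ 0) (x : ℕ) : 1 ≤ cichon h o x :=
  succ_le_cichon ho (Nat.zero_le _)

theorem mainTheorem7 (d k : ℕ) (hd : 1 ≤ d) (α : NONote)
    (hα : α.repr = Ordinal.omega0 ^ (Ordinal.omega0 ^ (d - 1) * ((2 ^ d * k : ℕ) : Ordinal.{0}))) :
    ∃ c : ℕ, ∀ g : ℕ → ℕ, StrictMono g → (∀ n, n ≤ g n) →
      ∀ᶠ n : ℕ in Filter.atTop,
        (((NormedQO.nat.power d).minoring).power k).lengthFunction g n ≤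
          (cichon (fun x => 4 * k * x * (g x + 1) ^ d) α.val (c * g n ^ (2 * d)) : ℕ∞) := by
  -- With one cell of `m = 2 ^ d * k` slices, `control_start` needs `d + (m + d * n) + (1 + m * n ^
  -- d)`, and each of `n`, `n ^ d`, `1` is at most `g n ^ (2 * d)`.
  refine ⟨2 * d + 2 * (2 ^ d * k) + 1, fun g hg hgn => ?_⟩
  filter_upwards [Filter.eventually_ge_atTop 1] with n hn
  refine iSup₂_le fun l ⟨X, hctrl, hbad⟩ => Nat.cast_le.2 ?_
  have hα0 : α.val ≠ 0 := by
    intro h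
    have h0 : α.repr = 0 := by
      change α.val.repr = 0
      rw [h, ONote.repr_zero]
    rw [hα] at h0
    exact (Ordinal.opow_pos _ Ordinal.omega0_pos).ne' h0
  -- For `k = 0` the control function vanishes, but any two elements are comparable, so bad
  -- sequences have length at most one.
  rcases Nat.eq_zero_or_pos k with rfl | hk
  · refine le_trans ?_ (one_le_cichon _ hα0 _)
    by_contra! hl
    exact hbad ⟨0, by omega⟩ ⟨1, hl⟩ (by simp [Fin.lt_def]) fun i => i.elim0
  · have hpos : ∀ i, 0 < g^[i] n := fun i =>
      hn.trans (Function.id_le_iterate_of_id_le hgn i n)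
    let Y : ℕ → Set ((Fin k × Finset (Fin d)) × (Fin d → ℕ)) := fun i =>
      if h : i < l then NormedQO.avoiding (X ⟨i, h⟩) (g^[i] n) else ∅
    have hY : ∀ i (h : i < l), Y i = NormedQO.avoiding (X ⟨i, h⟩) (g^[i] n) := fun i h => dif_pos h
    have hcard : Fintype.card (Fin k × Finset (Fin d)) = 2 ^ d * k := by
      simp [mul_comm]
    obtain ⟨h1, h2⟩ := control_start (m := 2 ^ d * k) hn hd (hgn n)
    refine Cell.length_le_cichon hd hk hg.monotone l Y n (2 ^ d * k) 1 _
      {Cell.top (Fin k × Finset (Fin d)) d} α.val α.2 ?_ ?_ ?_ ?_ (by simp) ?_ h1 h2 ?_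
    · intro i hi
      rw [hY i hi]
      exact NormedQO.isDown_avoiding _ _
    · intro i hi w hw
      rw [hY i hi] at hw
      exact hw.1
    · intro i j hij hj
      rw [hY i (hij.trans hj), hY j hj]
      exact fun h => hbad ⟨i, hij.trans hj⟩ ⟨j, hj⟩ hij
        (NormedQO.le_of_avoiding_subset (hpos i) (hctrl ⟨i, hij.trans hj⟩) h)
    · intro C hC
      obtain rfl := Multiset.mem_singleton.1 hC
      refine ⟨?_, fun σ hσ => ?_⟩
      · simp only [Cell.top, Multiset.card_map]
        exact hcard.le
      · obtain ⟨p, -, rfl⟩ := Multiset.mem_map.1 hσ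
        simpa using hd
    · exact fun i _ => ⟨_, Multiset.mem_singleton_self _, Cell.mem_top _⟩
    · change (Cell.ordinal _).repr ≤ α.repr
      rw [hα, Cell.repr_ordinal_top, hcard, Ordinal.opow_natCast]
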